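/- Let $p$ be a prime and let $R$ be a (noetherian) regular commutative ring of characteristic $p$ that is $F$-finite, i.e. the Frobenius $F\colon R\to R$, $r\mapsto r^p$, is a finite ring map. Let $D_R\subseteq \operatorname{End}_{\mathbb Z}(R)$ be the ring of (Grothendieck) differential operators of $R$; for $f\ge 0$ let $D_R^{(f)}$ be the ring of those operators in $D_R$ that are linear over the subring $R^{p^f}$ of $p^f$-th powers. For a left $D_R$-module $M$ let $T^f(M)\subseteq M$ be the set of all $m$ with $\delta m=0$ for every $\delta\in D_R^{(f)}$ such that $\delta(1)=0$. Let $e\ge 0$ and let $F^{e*}M=R\otimes_{F^e}M$ be the pullback of the $R$-module $M$ along $F^e\colon R\to R$, $r\mapsto r^{p^e}$. Then for every $D_R$-module $M$ there is exactly one $D_R$-module structure on $F^{e*}M$ which extends its $R$-module structure and satisfies $\delta\cdot(r\otimes m)=\delta(r)\otimes m$ for all $f\ge 0$, $\delta\in D_R^{(e+f)}$, $r\in R$ and $m\in T^f(M)$. For every $D_R$-linear map $\varphi\colon M\to M'$ the map $F^{e*}\varphi=\mathrm{id}_R\otimes\varphi$ is $D_R$-linear for these structures, and the resulting functor $F^{e*}$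 from the category of $D_R$-modules to itself is an equivalence of categories. -/

import Mathlib

universe u v w

open CategoryTheory

noncomputable section

namespace FrobDescent

section DifferentialOperators

variable (R : Type u) [CommRing R]

/-- Additive endomorphisms of `R` that are differential operators of order at most `n` in the sense
of Grothendieck: `δ` has order at most `0` if it commutes with all multiplications, and order at
most `n + 1` if all its commutators with multiplications have order at most `n`. -/
def IsDiffOp : ℕ → Module.End ℤ R → Prop
  | 0, δ => ∀ r : R, δ * LinearMap.mulLeft ℤ r - LinearMap.mulLeft ℤ r * δ = 0
  | n + 1, δ => ∀ r : R, IsDiffOp n (δ * LinearMap.mulLeft ℤ r - LinearMap.mulLeft ℤ r * δ)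

variable {R}

theorem isDiffOp_zero (n : ℕ) : IsDiffOp R n 0 := by
  induction n with
  | zero => intro r; simp
  | succ n ih => intro r; simpa using ih

theorem IsDiffOp.succ {n : ℕ} {δ : Module.End ℤ R} (h : IsDiffOp R n δ) : IsDiffOp R (n + 1) δ := by
  induction n generalizing δ with
  | zero => intro r; rw [h r]; exact isDiffOp_zero 0
  | succ n ih => intro r; exact ih (h r)

theorem IsDiffOp.mono {m n : ℕ} (hmn : m ≤ n) {δ : Module.End ℤ R} (h : IsDiffOp R m δ) :
    IsDiffOp R n δ := by
  induction hmn with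
  | refl => exact h
  | step _ ih => exact ih.succ

theorem IsDiffOp.add {n : ℕ} {δ ε : Module.End ℤ R} (hδ : IsDiffOp R n δ) (hε : IsDiffOp R n ε) :
    IsDiffOp R n (δ + ε) := by
  induction n generalizing δ ε with
  | zero =>
    intro r
    have h := congrArg₂ (· + ·) (hδ r) (hε r)
    simp only [add_zero] at h
    rw [← h]; noncomm_ring
  | succ n ih =>
    intro r
    have h := ih (hδ r) (hε r)
    convert h using 1
    noncomm_ring

theorem IsDiffOp.neg {n : ℕ} {δ : Module.End ℤ R} (hδ : IsDiffOp R n δ) : IsDiffOp R n (-δ) := by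
  induction n generalizing δ with
  | zero =>
    intro r
    rw [← neg_eq_zero, ← hδ r]; noncomm_ring
  | succ n ih =>
    intro r
    convert ih (hδ r) using 1
    noncomm_ring

theorem isDiffOp_mulLeft (r : R) : IsDiffOp R 0 (LinearMap.mulLeft ℤ r) := by
  intro s
  ext x
  simp [mul_left_comm]

theorem IsDiffOp.mul {m n : ℕ} {δ ε : Module.End ℤ R} (hδ : IsDiffOp R m δ)
    (hε : IsDiffOp R n ε) : IsDiffOp R (m + n) (δ * ε) := by
  have key : ∀ (r : R), δ * ε * LinearMap.mulLeft ℤ r - LinearMap.mulLeft ℤ r * (δ * ε) =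
      δ * (ε * LinearMap.mulLeft ℤ r - LinearMap.mulLeft ℤ r * ε) +
      (δ * LinearMap.mulLeft ℤ r - LinearMap.mulLeft ℤ r * δ) * ε := by
    intro r; noncomm_ring
  induction hk : m + n generalizing m n δ ε with
  | zero =>
    obtain ⟨rfl, rfl⟩ : m = 0 ∧ n = 0 := by omega
    intro r
    rw [key r, hδ r, hε r]; simp
  | succ k ih =>
    intro r
    rw [key r]
    refine IsDiffOp.add ?_ ?_
    · cases n with
      | zero => rw [hε r, mul_zero]; exact isDiffOp_zero k
      | succ n => exact ih hδ (hε r) (fun _ => by noncomm_ring) (by omega)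
    · cases m with
      | zero => rw [hδ r, zero_mul]; exact isDiffOp_zero k
      | succ m => exact ih (hδ r) hε (fun _ => by noncomm_ring) (by omega)

variable (R)

/-- The ring `D_R` of (absolute) differential operators of `R`. -/
def diffOp : Subring (Module.End ℤ R) where
  carrier := {δ | ∃ n, IsDiffOp R n δ}
  mul_mem' := fun ⟨_, hm⟩ ⟨_, hn⟩ => ⟨_, hm.mul hn⟩
  one_mem' := ⟨0, fun r => by simp⟩
  add_mem' := fun ⟨m, hm⟩ ⟨n, hn⟩ =>
    ⟨max m n, (hm.mono (le_max_left m n)).add (hn.mono (le_max_right m n))⟩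
  zero_mem' := ⟨0, isDiffOp_zero 0⟩
  neg_mem' := fun ⟨n, hn⟩ => ⟨n, hn.neg⟩

/-- The inclusion `R → D_R`; an element acts by multiplication. -/
def ofRing : R →+* diffOp R where
  toFun r := ⟨LinearMap.mulLeft ℤ r, 0, isDiffOp_mulLeft r⟩
  map_one' := by ext x; simp
  map_mul' r s := by ext x; simp
  map_zero' := by ext x; simp
  map_add' r s := by ext x; simp [add_mul]

/-- The underlying `R`-module of a `D_R`-module. -/
abbrev toRMod : ModuleCat.{w} (diffOp R) ⥤ ModuleCat.{w} R := ModuleCat.restrictScalars (ofRing R)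

end DifferentialOperators

section Tensor

/-- The pure tensor `s ⊗ m` in the extension of scalars `S ⊗_R M` along `f : R → S`. (This is stated
for two rings, so that for `R = S` the left factor carries the structure twisted by `f`.) -/
def pureTensor {R : Type u} {S : Type v} [CommRing R] [CommRing S] (f : R →+* S)
    {M : ModuleCat.{w} R} (s : S) (m : M) : (ModuleCat.extendScalars f).obj M :=
  TensorProduct.tmul R (M := (ModuleCat.restrictScalars f).obj (ModuleCat.of S S)) s m

end Tensor

variable (R : Type u) [CommRing R] (p : ℕ) [Fact p.Prime] [CharP R p]

/-- Membership of an operator in `D_R^{(e)} = End_{R^{p^e}}(R)`: linearity over the subring of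
`p^e`-th powers. -/
def HasLevel (e : ℕ) (δ : diffOp R) : Prop :=
  ∀ s x : R, δ.1 (s ^ p ^ e * x) = s ^ p ^ e * δ.1 x

/-- Membership of `m` in `T^f(M) = Ann_M(J_f)`, where `J_f` is the left ideal of `D_R^{(f)}`
consisting of the operators `δ` with `δ(1) = 0`. -/
def IsHorizontal (f : ℕ) {M : ModuleCat.{w} (diffOp R)} (m : M) : Prop :=
  ∀ δ : diffOp R, HasLevel R p f δ → δ.1 1 = 0 → δ • m = 0

/-- The Frobenius pullback `F^{e*} M = R ⊗_{F^e} M`, with its `R`-module structure. -/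
abbrev frobPullback (e : ℕ) : ModuleCat.{max u v} R ⥤ ModuleCat.{max u v} R :=
  ModuleCat.extendScalars.{u, u, max u v} (iterateFrobenius R p e)

/-- The natural `D_R`-module structures on `F^{e*} M`, for a `D_R`-module `M`: those that extend the
`R`-module structure and in which an operator `δ ∈ D_R^{(e+f)}` acts as `δ ⊗ id` on the tensors
`r ⊗ m` with `m ∈ T^f(M)`, that is, through `F^{e*} M = F^{e*} F^{f*} N = F^{(e+f)*} N` for
`N = T^f(M)`. -/
@[ext]
structure NaturalStructure (e : ℕ) (M : ModuleCat.{max u v} (diffOp R)) where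
  /-- The action of `D_R`. -/
  toModule : Module (diffOp R) ((frobPullback.{u, v} R p e).obj ((toRMod R).obj M))
  ofRing_smul : ∀ (r : R) (x : (frobPullback.{u, v} R p e).obj ((toRMod R).obj M)),
    toModule.smul (ofRing R r) x = r • x
  smul_tensor : ∀ (f : ℕ) (δ : diffOp R) (r : R) (m : M),
    HasLevel R p (e + f) δ → IsHorizontal R p f m →
    toModule.smul δ (pureTensor (iterateFrobenius R p e) (M := (toRMod R).obj M) r m) =
      pureTensor (iterateFrobenius R p e) (M := (toRMod R).obj M) (δ.1 r) m

variable {R p}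

/-- `F^{e*} M` as a `D_R`-module. -/
def NaturalStructure.obj {e : ℕ} {M : ModuleCat.{max u v} (diffOp R)}
    (S : NaturalStructure.{u, v} R p e M) : ModuleCat.{max u v} (diffOp R) :=
  letI := S.toModule
  ModuleCat.of (diffOp R) ((frobPullback.{u, v} R p e).obj ((toRMod R).obj M))

/-- For all `D_R`-linear `φ : M → M'`, the map `F^{e*} φ = id ⊗ φ` is `D_R`-linear. -/
def IsFunctorial {e : ℕ} (S : ∀ M, NaturalStructure.{u, v} R p e M) : Prop :=
  ∀ ⦃M M' : ModuleCat.{max u v} (diffOp R)⦄ (φ : M ⟶ M') (δ : diffOp R)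
    (x : (frobPullback.{u, v} R p e).obj ((toRMod R).obj M)),
    ((frobPullback.{u, v} R p e).map ((toRMod R).map φ)).hom ((S M).toModule.smul δ x) =
      (S M').toModule.smul δ (((frobPullback.{u, v} R p e).map ((toRMod R).map φ)).hom x)

/-- The functor `F^{e*}` from `D_R`-modules to `D_R`-modules. -/
def frobFunctor {e : ℕ} (S : ∀ M, NaturalStructure.{u, v} R p e M) (hS : IsFunctorial S) :
    ModuleCat.{max u v} (diffOp R) ⥤ ModuleCat.{max u v} (diffOp R) where
  obj M := (S M).obj
  map {M M'} φ :=
    letI := (S M).toModule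
    letI := (S M').toModule
    ModuleCat.ofHom
      { toFun := ((frobPullback.{u, v} R p e).map ((toRMod R).map φ)).hom
        map_add' := map_add _
        map_smul' := hS φ }
  map_id M := by
    ext x
    change ((frobPullback.{u, v} R p e).map ((toRMod R).map (𝟙 M))).hom x = x
    simp
  map_comp {M M' M''} φ ψ := by
    ext x
    change ((frobPullback.{u, v} R p e).map ((toRMod R).map (φ ≫ ψ))).hom x =
      ((frobPullback.{u, v} R p e).map ((toRMod R).map ψ)).hom
        (((frobPullback.{u, v} R p e).map ((toRMod R).map φ)).hom x)
    rw [Functor.map_comp, Functor.map_comp]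
    rfl

end FrobDescent

end

/-!
Since `R` is `F`-finite, the differential operators of `R` are the additive maps which are linear
over some `R^{p^f}`: the `p^f`-th power of `1 ⊗ r - r ⊗ 1` is `1 ⊗ r^{p^f} - r^{p^f} ⊗ 1`, so powers
of the ideal of the diagonal and linearity over `p`-power subrings control each other. Since `R` is
regular, Frobenius is flat (Kunz): the maximal ideal of a regular local ring is generated by a
regular sequence, whose `p`-th powers again form a regular sequence, and this makes `F_* R` free. So
`F^e_* R` is a finite projective `R`-module, and it is a generator because no maximal ideal contains
the values at `1` of all the maps in `Hom(F^e_* R, R)`.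

Write `P = Hom(R, F^e_* R)` and `Q = Hom(F^e_* R, R)` for the bimodules of differential operators.
A dual basis of `F^e_* R` consists of `g i ∈ P` and `κ i ∈ Q` with `∑ i, g i * κ i = 1`, and for
the same reason `F^{e*} M = P ⊗ M` over `D_R`, where `P` acts on the left. This is the required
structure. It is unique because every `D_R`-module is generated over `R` by its horizontal elements,
again by the dual basis, now for `F^f` with `f` large. Composition makes `P` and `Q` into a Morita
context between `D_R` and itself, both pairings of which are surjective, so that `P ⊗ -` is an
equivalence with inverse `Hom(P, -)`.
-/

noncomputable section

namespace FrobDescent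

section RegularLocalRings

open IsLocalRing RingTheory.Sequence Pointwise

variable {R : Type u} [CommRing R]

theorem isWeaklyRegular_append_map_pow [IsLocalRing R] {M : Type*} [AddCommGroup M] [Module R M]
    [IsNoetherian R M] {n : ℕ} (hn : n ≠ 0) {as bs : List R}
    (h : IsWeaklyRegular M (as ++ bs)) (hm : ∀ r ∈ as ++ bs, r ∈ maximalIdeal R) :
    IsWeaklyRegular M (as ++ bs.map (· ^ n)) := by
  induction bs generalizing as with
  | nil => exact h
  | cons x bs ih =>
    have hx : x ∈ maximalIdeal R := hm x (by simp)
    have hlast : IsWeaklyRegular M ((as ++ bs) ++ [x]) :=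
      isWeaklyRegular_of_perm_of_subset_maximalIdeal h
        (by rw [List.append_assoc]; exact (List.perm_append_singleton x bs).symm.append_left as) hm
    rw [isWeaklyRegular_append_iff, isWeaklyRegular_singleton_iff] at hlast
    have hpow : IsWeaklyRegular M ((as ++ bs) ++ [x ^ n]) := by
      rw [isWeaklyRegular_append_iff, isWeaklyRegular_singleton_iff]
      exact ⟨hlast.1, hlast.2.pow n⟩
    have hperm : (as ++ bs ++ [x ^ n]).Perm (as ++ [x ^ n] ++ bs) := by
      simpa only [List.append_assoc] using List.perm_append_comm.append_left as
    have hmem : ∀ r ∈ as ++ bs ++ [x ^ n], r ∈ maximalIdeal R := by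
      simp only [List.mem_append, List.mem_cons] at hm ⊢
      rintro r ((hr | hr) | hr)
      · exact hm r (.inl hr)
      · exact hm r (.inr (.inr hr))
      · obtain rfl : r = x ^ n := by simpa using hr
        exact Ideal.pow_mem_of_mem _ hx n (by omega)
    simpa using ih (isWeaklyRegular_of_perm_of_subset_maximalIdeal hpow hperm hmem)
      fun r hr => hmem r (hperm.mem_iff.2 hr)

theorem exists_insert_span_eq_of_notMem_smul [IsLocalRing R] {M : Type*} [AddCommGroup M]
    [Module R M] {N : Submodule R M} (hN : N.FG) {x : M} (hx : x ∈ N)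
    (hx' : x ∉ maximalIdeal R • N) :
    ∃ s : Finset M, Submodule.span R (insert x (s : Set M)) = N ∧ s.card + 1 = N.spanFinrank := by
  classical
  obtain ⟨t, ht, rfl⟩ := Submodule.FG.exists_span_finset_card_eq_spanFinrank hN
  obtain ⟨c, -, rfl⟩ := Submodule.mem_span_finset.1 hx
  obtain ⟨a, ha, hca⟩ : ∃ a ∈ t, IsUnit (c a) := by
    by_contra! hc
    exact hx' (Submodule.sum_mem _ fun a ha =>
      Submodule.smul_mem_smul (hc a ha) (Submodule.subset_span ha))
  refine ⟨t.erase a, le_antisymm (Submodule.span_le.2 ?_) (Submodule.span_le.2 ?_), ?_⟩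
  · rw [Set.insert_subset_iff]
    exact ⟨hx, fun b hb => Submodule.subset_span (Finset.mem_of_mem_erase hb)⟩
  · intro b hb
    by_cases hba : b = a
    · subst hba
      rw [SetLike.mem_coe, ← Submodule.smul_mem_iff_of_isUnit _ hca,
        ← add_sub_cancel_right (c b • b) (∑ i ∈ t.erase b, c i • i),
        Finset.add_sum_erase t (fun i => c i • i) ha]
      refine Submodule.sub_mem _ (Submodule.subset_span (Set.mem_insert _ _))
        (Submodule.sum_mem _ fun i hi => Submodule.smul_mem _ _ ?_)
      exact Submodule.subset_span (Set.mem_insert_of_mem _ hi)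
    · exact Submodule.subset_span (Set.mem_insert_of_mem _ (Finset.mem_erase.2 ⟨hba, hb⟩))
  · rw [Finset.card_erase_add_one ha, ht]

theorem not_maximalIdeal_le_sq [IsLocalRing R] [IsNoetherianRing R] (h : maximalIdeal R ≠ ⊥) :
    ¬ maximalIdeal R ≤ maximalIdeal R ^ 2 := fun hle =>
  ((Ideal.isIdempotentElem_iff_eq_bot_or_top_of_isLocalRing _).1
    (le_antisymm Ideal.mul_le_left (hle.trans_eq (pow_two _)))).elim
    h (maximalIdeal.isMaximal R).ne_top

theorem isRegularLocalRing_quotient_span_singleton [IsRegularLocalRing R] {x : R}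
    (hx : x ∈ maximalIdeal R) (hx2 : x ∉ maximalIdeal R ^ 2) :
    ∃ _ : IsRegularLocalRing (R ⧸ Ideal.span {x}),
      (maximalIdeal (R ⧸ Ideal.span {x})).spanFinrank + 1 = (maximalIdeal R).spanFinrank := by
  classical
  have : Nontrivial (R ⧸ Ideal.span {x}) := Ideal.Quotient.nontrivial_iff.2
    fun h => (maximalIdeal.isMaximal R).ne_top
      (top_le_iff.1 (h ▸ (Ideal.span_singleton_le_iff_mem _).2 hx))
  have : IsLocalRing (R ⧸ Ideal.span {x}) :=
    .of_surjective' (Ideal.Quotient.mk _) Ideal.Quotient.mk_surjective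
  obtain ⟨s, hs, hcard⟩ := exists_insert_span_eq_of_notMem_smul
    (IsNoetherian.noetherian (maximalIdeal R)) hx (by rwa [smul_eq_mul, ← pow_two])
  have hmap : maximalIdeal (R ⧸ Ideal.span {x}) =
      Ideal.span (Ideal.Quotient.mk (Ideal.span {x}) '' s) := by
    rw [← map_maximalIdeal_of_surjective _ Ideal.Quotient.mk_surjective, ← hs,
      Ideal.submodule_span_eq, Ideal.map_span, Set.image_insert_eq,
      Ideal.Quotient.eq_zero_iff_mem.2 (Ideal.mem_span_singleton_self x)]
    exact Submodule.span_insert_zero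
  have hle : (maximalIdeal (R ⧸ Ideal.span {x})).spanFinrank ≤ s.card := by
    rw [hmap, ← Finset.coe_image]
    refine (Submodule.spanFinrank_span_le_ncard_of_finite (Finset.finite_toSet _)).trans ?_
    rw [Set.ncard_coe_finset]
    exact Finset.card_image_le
  have hdim : (s.card : WithBot ℕ∞) ≤ ringKrullDim (R ⧸ Ideal.span {x}) := by
    have h := ringKrullDim_le_ringKrullDim_quotient_add_card (R := R) {x} (by
      rw [ringJacobson_eq_maximalIdeal]; simpa using hx)
    rw [← IsRegularLocalRing.spanFinrank_maximalIdeal, ← hcard, Finset.coe_singleton,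
      Finset.card_singleton, Nat.cast_add] at h
    exact (ENat.WithBot.add_le_add_natCast_right_iff (c := 1)).1 h
  have hreg : IsRegularLocalRing (R ⧸ Ideal.span {x}) :=
    .of_spanFinrank_maximalIdeal_le _ ((Nat.cast_le.2 hle).trans hdim)
  refine ⟨hreg, ?_⟩
  rw [← hreg.spanFinrank_maximalIdeal, Nat.cast_le] at hdim
  rw [← hcard, hle.antisymm hdim]

theorem isDomain_of_isPrime_span_singleton [IsLocalRing R] [IsNoetherianRing R] {x : R}
    (hx : x ∈ maximalIdeal R) (hprime : (Ideal.span {x}).IsPrime)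
    (hmin : ∀ P ∈ minimalPrimes R, x ∉ P) : IsDomain R := by
  obtain ⟨P, hP, hPx⟩ := Ideal.exists_minimalPrimes_le (bot_le : (⊥ : Ideal R) ≤ Ideal.span {x})
  have hPprime : P.IsPrime := hP.1.1
  have hP_le : P ≤ Ideal.span {x} • P := fun y hy => by
    obtain ⟨z, rfl⟩ := Ideal.mem_span_singleton'.1 (hPx hy)
    rw [mul_comm]
    exact Submodule.smul_mem_smul (Ideal.mem_span_singleton_self x)
      ((hPprime.mem_or_mem hy).resolve_right (hmin P hP))
  have hbot : P = ⊥ := Submodule.eq_bot_of_le_smul_of_le_jacobson_bot _ _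
    (IsNoetherian.noetherian _) hP_le (by
      rw [jacobson_eq_maximalIdeal _ bot_ne_top]
      exact (Ideal.span_singleton_le_iff_mem _).2 hx)
  rw [hbot] at hPprime
  exact IsDomain.of_bot_isPrime R

theorem exists_notMem_sq_notMem_minimalPrimes [IsLocalRing R] [IsNoetherianRing R]
    (hbot : maximalIdeal R ≠ ⊥) (hmin : maximalIdeal R ∉ minimalPrimes R) :
    ∃ x ∈ maximalIdeal R, x ∉ maximalIdeal R ^ 2 ∧ ∀ P ∈ minimalPrimes R, x ∉ P := by
  by_contra! hcover
  have hsub : (maximalIdeal R : Set R) ⊆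
      ⋃ I ∈ insert (maximalIdeal R ^ 2) (minimalPrimes R), (I : Set R) := fun x hx => by
    simp only [Set.mem_iUnion, Set.mem_insert_iff, exists_prop, SetLike.mem_coe]
    by_cases hx2 : x ∈ maximalIdeal R ^ 2
    · exact ⟨_, .inl rfl, hx2⟩
    · obtain ⟨P, hP, hxP⟩ := hcover x hx hx2
      exact ⟨P, .inr hP, hxP⟩
  obtain ⟨I, rfl | hI, hle⟩ := (Ideal.subset_union_prime_finite
    ((minimalPrimes.finite_of_isNoetherianRing R).insert _) (f := id) (maximalIdeal R ^ 2)
    (maximalIdeal R ^ 2) fun I hI hne _ => (hI.resolve_left hne).1.1).1 hsub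
  · exact not_maximalIdeal_le_sq hbot hle
  · exact hmin (le_antisymm (le_maximalIdeal hI.1.1.ne_top) hle ▸ hI)

theorem maximalIdeal_notMem_minimalPrimes [IsRegularLocalRing R] (hbot : maximalIdeal R ≠ ⊥) :
    maximalIdeal R ∉ minimalPrimes R := fun hmin => by
  refine hbot ((Submodule.spanFinrank_eq_zero_iff_eq_bot (IsNoetherian.noetherian _)).1 ?_)
  have hdim := IsRegularLocalRing.spanFinrank_maximalIdeal (R := R)
  rw [← maximalIdeal_height_eq_ringKrullDim, Ideal.height_eq_zero_iff.2 hmin] at hdim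
  exact_mod_cast hdim

theorem isDomain_of_isRegularLocalRing [IsRegularLocalRing R] : IsDomain R := by
  induction hn : (maximalIdeal R).spanFinrank generalizing R with
  | zero =>
    exact (isField_iff_maximalIdeal_eq.2 ((Submodule.spanFinrank_eq_zero_iff_eq_bot
      (IsNoetherian.noetherian _)).1 hn)).isDomain
  | succ n ih =>
    have hbot : maximalIdeal R ≠ ⊥ := fun h => by simp [h] at hn
    obtain ⟨x, hx, hx2, hmin⟩ := exists_notMem_sq_notMem_minimalPrimes hbot
      (maximalIdeal_notMem_minimalPrimes hbot)
    obtain ⟨_, hrank⟩ := isRegularLocalRing_quotient_span_singleton hx hx2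
    have := ih (R := R ⧸ Ideal.span {x}) (by omega)
    exact isDomain_of_isPrime_span_singleton hx ((Ideal.Quotient.isDomain_iff_prime _).1 this) hmin

theorem exists_isWeaklyRegular_ofList_eq_maximalIdeal [IsRegularLocalRing R] :
    ∃ rs : List R, Ideal.ofList rs = maximalIdeal R ∧ IsWeaklyRegular R rs := by
  induction hn : (maximalIdeal R).spanFinrank generalizing R with
  | zero =>
    refine ⟨[], ?_, .nil R R⟩
    rw [Ideal.ofList_nil, (Submodule.spanFinrank_eq_zero_iff_eq_bot
      (IsNoetherian.noetherian (maximalIdeal R))).1 hn]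
  | succ n ih =>
    have := isDomain_of_isRegularLocalRing (R := R)
    obtain ⟨x, hx, hx2⟩ := SetLike.not_le_iff_exists.1
      (not_maximalIdeal_le_sq (R := R) fun h => by simp [h] at hn)
    obtain ⟨_, hrank⟩ := isRegularLocalRing_quotient_span_singleton hx hx2
    obtain ⟨rs', hgen, hreg⟩ := ih (R := R ⧸ Ideal.span {x}) (by omega)
    obtain ⟨rs, rfl⟩ := List.map_surjective_iff.2 Ideal.Quotient.mk_surjective rs'
    refine ⟨x :: rs, ?_, .cons ?_ ?_⟩
    · rw [← Ideal.map_ofList,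
        ← map_maximalIdeal_of_surjective _ Ideal.Quotient.mk_surjective] at hgen
      have hcomap := congrArg (Ideal.comap (Ideal.Quotient.mk (Ideal.span {x}))) hgen
      rw [Ideal.comap_map_quotientMk, Ideal.comap_map_quotientMk,
        sup_of_le_right ((Ideal.span_singleton_le_iff_mem _).2 hx)] at hcomap
      rw [Ideal.ofList_cons, hcomap]
    · exact IsSMulRegular.of_ne_zero (by rintro rfl; exact hx2 (zero_mem _))
    · refine (LinearEquiv.isWeaklyRegular_congr (Submodule.quotEquivOfEq (Ideal.span {x})
        (x • (⊤ : Ideal R)) ?_) rs).1 ((isWeaklyRegular_map_algebraMap_iff _ _ rs).1 hreg)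
      simp [← Submodule.ideal_span_singleton_smul]

theorem free_of_isWeaklyRegular [IsLocalRing R] [IsNoetherianRing R]
    {M : Type w} [AddCommGroup M] [Module R M] [Module.Finite R M] {rs : List R}
    (hrs : Ideal.ofList rs = maximalIdeal R) (h : IsWeaklyRegular M rs) : Module.Free R M := by
  induction hn : rs.length generalizing R M rs with
  | zero =>
    obtain rfl := List.length_eq_zero_iff.1 hn
    have hR : IsField R := isField_iff_maximalIdeal_eq.2 (by rw [← hrs, Ideal.ofList_nil])
    let := hR.toField
    exact Module.Free.of_divisionRing R M
  | succ n ih =>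
    obtain ⟨x, rs, rfl⟩ := List.exists_cons_of_length_eq_add_one hn
    rw [isWeaklyRegular_cons_iff'] at h
    have hx : Ideal.span {x} ≤ maximalIdeal R := by
      rw [← hrs, Ideal.ofList_cons]; exact le_sup_left
    have : Nontrivial (R ⧸ Ideal.span {x}) :=
      Ideal.Quotient.nontrivial_iff.2 (hx.trans_lt (maximalIdeal.isMaximal R).ne_top.lt_top).ne
    have : IsLocalRing (R ⧸ Ideal.span {x}) :=
      .of_surjective' (Ideal.Quotient.mk _) Ideal.Quotient.mk_surjective
    have : Module.Finite (R ⧸ Ideal.span {x}) (QuotSMulTop x M) :=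
      .of_restrictScalars_finite R _ _
    have hgen : Ideal.ofList (rs.map (Ideal.Quotient.mk (Ideal.span {x}))) =
        maximalIdeal (R ⧸ Ideal.span {x}) := by
      rw [← map_maximalIdeal_of_surjective _ Ideal.Quotient.mk_surjective, ← hrs,
        Ideal.ofList_cons, Ideal.map_sup, Ideal.map_ofList, Ideal.map_quotient_self, bot_sup_eq]
    have : Module.FinitePresentation R M := Module.finitePresentation_of_finite R M
    refine (Module.free_quotSMulTop_iff_free R M ?_ h.1).1 (ih hgen h.2 (by simpa using hn))
    rw [jacobson_eq_maximalIdeal _ bot_ne_top]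
    exact (Ideal.span_singleton_le_iff_mem _).1 hx

end RegularLocalRings

section Kunz

open IsLocalRing RingTheory.Sequence

theorem flat_of_isWeaklyRegular_map {R S : Type*} [CommRing R] [IsLocalRing R] [IsNoetherianRing R]
    [CommRing S] {f : R →+* S} (hf : f.Finite) {rs : List R}
    (hrs : Ideal.ofList rs = maximalIdeal R) (h : IsWeaklyRegular S (rs.map f)) : f.Flat := by
  algebraize [f]
  have := free_of_isWeaklyRegular hrs
    ((isWeaklyRegular_map_algebraMap_iff (R := R) (S := S) (M := S) rs).1 h)
  exact inferInstanceAs (Module.Flat R S)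

variable {R : Type u} [CommRing R] {p : ℕ} [Fact p.Prime] [CharP R p]

theorem frobenius_flat_of_isRegularLocalRing [IsRegularLocalRing R]
    (hF : (frobenius R p).Finite) : (frobenius R p).Flat := by
  obtain ⟨rs, hrs, h⟩ := exists_isWeaklyRegular_ofList_eq_maximalIdeal (R := R)
  refine flat_of_isWeaklyRegular_map hF hrs
    (isWeaklyRegular_append_map_pow (as := []) (NeZero.ne p) h fun r hr => ?_)
  rw [← hrs]
  exact Ideal.subset_span hr

theorem finite_frobenius_of_isLocalization (M : Submonoid R) (A : Type u) [CommRing A] [CharP A p]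
    [Algebra R A] [IsLocalization M A] (hF : (frobenius R p).Finite) : (frobenius A p).Finite := by
  have hle : M.map (frobenius R p) ≤ M := by
    rintro _ ⟨m, hm, rfl⟩
    exact pow_mem hm p
  have : IsLocalization (M.map (frobenius R p)) A :=
    (IsLocalization.iff_of_le_of_exists_dvd _ M hle fun m hm =>
      ⟨m ^ p, ⟨m, hm, rfl⟩, dvd_pow_self m (NeZero.ne p)⟩).2 ‹_›
  convert RingHom.finite_localizationPreserves (frobenius R p) M A A hF
  refine IsLocalization.ringHom_ext M (RingHom.ext fun r => ?_)
  simp [frobenius_def]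

theorem frobenius_flat_of_isRegularRing [IsRegularRing R] (hF : (frobenius R p).Finite) :
    (frobenius R p).Flat := by
  refine RingHom.Flat.ofLocalizationPrime _ fun P hP => ?_
  suffices ∀ (Q : Ideal R) [Q.IsPrime] (h : Q = P.comap (frobenius R p)),
      (Localization.localRingHom Q P (frobenius R p) h).Flat from this _ rfl
  intro Q hQ h
  obtain rfl : Q = P := h.trans (Ideal.ext fun r => hP.pow_mem_iff_mem p (NeZero.pos p))
  have : CharP (Localization.AtPrime Q) p := (CharP.charP_iff_prime_eq_zero Fact.out).2 <| by
    rw [← map_natCast (algebraMap R _), CharP.cast_eq_zero, map_zero]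
  rw [Localization.localRingHom_unique Q Q (frobenius R p) h
    (j := frobenius (Localization.AtPrime Q) p) fun r => by simp [frobenius_def]]
  exact frobenius_flat_of_isRegularLocalRing (finite_frobenius_of_isLocalization Q.primeCompl _ hF)

end Kunz

section Iterates

variable {R : Type u} [CommRing R] {p : ℕ} [Fact p.Prime] [CharP R p]

theorem iterateFrobenius_induction {P : (R →+* R) → Prop} (hid : P (RingHom.id R))
    (hcomp : ∀ {f g : R →+* R}, P f → P g → P (f.comp g))
    (hF : P (frobenius R p)) (e : ℕ) : P (iterateFrobenius R p e) := by
  induction e with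
  | zero => rwa [iterateFrobenius_zero]
  | succ e ih => rw [iterateFrobenius_add, iterateFrobenius_one]; exact hcomp ih hF

end Iterates

section Sandwich

open TensorProduct

variable (k : Type u) (R : Type v) [CommRing k] [CommRing R] [Algebra k R]

/-- The action of `R ⊗ R` on the endomorphisms of `R` in which `a ⊗ b` sends `δ` to
`x ↦ a * δ (b * x)`. -/
def sandwich : R ⊗[k] R →ₐ[k] Module.End k (Module.End k R) :=
  Algebra.TensorProduct.lift ((Algebra.lmul k (Module.End k R)).comp (Algebra.lmul k R))
    (.ofLinearMap ((LinearMap.mul k (Module.End k R)).flip ∘ₗ (Algebra.lmul k R).toLinearMap)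
      (by ext; simp) (fun r s => by ext; simp [mul_assoc, mul_left_comm]))
    fun r s => by rw [commute_iff_eq]; ext; simp [mul_assoc]

variable {k R}

@[simp]
theorem sandwich_tmul_apply_apply (a b : R) (δ : Module.End k R) (x : R) :
    sandwich k R (a ⊗ₜ b) δ x = a * δ (b * x) := by
  simp [sandwich]

/-- The ideal of `R ⊗ R` which annihilates `δ` under `sandwich`. -/
def sandwichAnnihilator (δ : Module.End k R) : Ideal (R ⊗[k] R) where
  carrier := {t | sandwich k R t δ = 0}
  add_mem' {s t} hs ht := by
    change sandwich k R (s + t) δ = 0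
    rw [map_add, LinearMap.add_apply, hs, ht, add_zero]
  zero_mem' := by simp
  smul_mem' s t ht := by
    change sandwich k R (s * t) δ = 0
    rw [map_mul, Module.End.mul_apply, ht, map_zero]

theorem mem_sandwichAnnihilator {δ : Module.End k R} {t : R ⊗[k] R} :
    t ∈ sandwichAnnihilator δ ↔ sandwich k R t δ = 0 := Iff.rfl

theorem tmul_sub_tmul_mem_sandwichAnnihilator_iff {δ : Module.End k R} {r : R} :
    1 ⊗ₜ r - r ⊗ₜ 1 ∈ sandwichAnnihilator δ ↔ ∀ x, δ (r * x) = r * δ x := by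
  simp [mem_sandwichAnnihilator, LinearMap.ext_iff, sub_eq_zero]

theorem isDiffOp_iff_ideal_pow_le (n : ℕ) (δ : Module.End k R) :
    IsDiffOp R n (δ.restrictScalars ℤ) ↔
      KaehlerDifferential.ideal k R ^ (n + 1) ≤ sandwichAnnihilator δ := by
  have hcomm (δ : Module.End k R) (r : R) :
      δ.restrictScalars ℤ * LinearMap.mulLeft ℤ r - LinearMap.mulLeft ℤ r * δ.restrictScalars ℤ =
        (sandwich k R (1 ⊗ₜ r - r ⊗ₜ 1) δ).restrictScalars ℤ := by
    ext x; simp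
  induction n generalizing δ with
  | zero =>
    rw [zero_add, pow_one, ← KaehlerDifferential.span_range_eq_ideal, Ideal.span_le,
      Set.range_subset_iff]
    refine forall_congr' fun r => ?_
    rw [hcomm, SetLike.mem_coe, mem_sandwichAnnihilator]
    exact (LinearMap.restrictScalars_injective ℤ).eq_iff' rfl
  | succ n ih =>
    simp only [IsDiffOp, hcomm, ih]
    rw [pow_succ' _ (n + 1), Ideal.mul_le]
    refine ⟨fun h t ht s hs => ?_, fun h r s hs => ?_⟩
    · rw [← KaehlerDifferential.span_range_eq_ideal] at ht
      induction ht using Submodule.span_induction with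
      | mem t ht =>
        obtain ⟨r, rfl⟩ := ht
        have := h r hs
        rwa [mem_sandwichAnnihilator, ← Module.End.mul_apply, ← map_mul, mul_comm] at this
      | zero => rw [zero_mul]; exact zero_mem _
      | add t t' _ _ ht ht' => rw [add_mul]; exact add_mem ht ht'
      | smul a t _ ht => rw [smul_eq_mul, mul_assoc]; exact Ideal.mul_mem_left _ a ht
    · have := h _ (KaehlerDifferential.one_smul_sub_smul_one_mem_ideal k r) s hs
      rwa [mem_sandwichAnnihilator, ← Module.End.mul_apply, ← map_mul, mul_comm]

end Sandwich

section PowLinear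

open TensorProduct

variable {R : Type u} [CommRing R] {p : ℕ}

theorem tmul_sub_tmul_pow_char_pow {k : Type v} [CommRing k] [Algebra k R] [Fact p.Prime]
    [CharP R p] (r : R) (e : ℕ) :
    ((1 ⊗ₜ r - r ⊗ₜ 1 : R ⊗[k] R)) ^ p ^ e = 1 ⊗ₜ (r ^ p ^ e) - (r ^ p ^ e) ⊗ₜ 1 := by
  have : Nontrivial R := CharP.nontrivial_of_char_ne_one (Fact.out : p.Prime).ne_one
  have : Nontrivial (R ⊗[k] R) :=
    (Algebra.TensorProduct.lmul' k (S := R)).toRingHom.domain_nontrivial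
  have : CharP (R ⊗[k] R) p := (CharP.charP_iff_prime_eq_zero Fact.out).2 <| by
    rw [← map_natCast (algebraMap R _), CharP.cast_eq_zero, map_zero]
  rw [sub_pow_char_pow]
  simp

theorem exists_isDiffOp_of_pow_mem_range {k : Type v} [CommRing k] [Algebra k R] [Fact p.Prime]
    [CharP R p] [Algebra.EssFiniteType k R] {e : ℕ}
    (h : ∀ r : R, r ^ p ^ e ∈ (algebraMap k R).range) (δ : Module.End k R) :
    ∃ n, IsDiffOp R n (δ.restrictScalars ℤ) := by
  have hnil : IsNilpotent (KaehlerDifferential.ideal k R) := by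
    rw [(KaehlerDifferential.ideal_fg k R).isNilpotent_iff_le_nilradical,
      ← KaehlerDifferential.span_range_eq_ideal, Ideal.span_le, Set.range_subset_iff]
    refine fun r => ⟨p ^ e, ?_⟩
    obtain ⟨a, ha⟩ := h r
    rw [tmul_sub_tmul_pow_char_pow, ← ha, Algebra.TensorProduct.tmul_one_eq_one_tmul, sub_self]
    exact zero_mem _
  obtain ⟨n, hn⟩ := hnil
  refine ⟨n, (isDiffOp_iff_ideal_pow_le n δ).2 ?_⟩
  rw [pow_succ, hn, zero_mul]
  exact bot_le

variable (p) in
/-- `φ (s ^ p ^ a * x) = s ^ p ^ b * φ x`, that is, `R`-linearity of `φ : F^a_* R → F^b_* R`. For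
`a = b` these are the operators of level `a`, the case `b = 0` consists of the Cartier maps and the
case `a = 0` contains the Frobenius `F^b`. -/
def IsPowLinear (a b : ℕ) (φ : Module.End ℤ R) : Prop :=
  ∀ s x : R, φ (s ^ p ^ a * x) = s ^ p ^ b * φ x

namespace IsPowLinear

variable {a b c : ℕ} {φ ψ : Module.End ℤ R}

theorem zero : IsPowLinear p a b (0 : Module.End ℤ R) := fun s x => by simp

theorem add (hφ : IsPowLinear p a b φ) (hψ : IsPowLinear p a b ψ) :
    IsPowLinear p a b (φ + ψ) := fun s x => by
  simp only [LinearMap.add_apply, hφ s x, hψ s x, mul_add]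

theorem mul (hφ : IsPowLinear p b c φ) (hψ : IsPowLinear p a b ψ) :
    IsPowLinear p a c (φ * ψ) := fun s x => by
  simp only [Module.End.mul_apply, hψ s x, hφ s (ψ x)]

theorem shift (h : IsPowLinear p a b φ) (k : ℕ) : IsPowLinear p (k + a) (k + b) φ := fun s x => by
  simp only [pow_add, pow_mul, h (s ^ p ^ k) x]

theorem mulLeft (r : R) : IsPowLinear p a a (LinearMap.mulLeft ℤ r) := fun s x => by
  simp only [LinearMap.mulLeft_apply, mul_left_comm]

end IsPowLinear

variable [Fact p.Prime] [CharP R p]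

theorem exists_isPowLinear_of_isDiffOp {n : ℕ} {δ : Module.End ℤ R} (h : IsDiffOp R n δ) :
    ∃ f, IsPowLinear p f f δ := by
  refine ⟨n + 1, fun s x => tmul_sub_tmul_mem_sandwichAnnihilator_iff.1 ?_ x⟩
  rw [← tmul_sub_tmul_pow_char_pow]
  exact (isDiffOp_iff_ideal_pow_le n δ).1 h (Ideal.pow_le_pow_right
    (Nat.lt_pow_self (Fact.out : p.Prime).one_lt).le
    (Ideal.pow_mem_pow (KaehlerDifferential.one_smul_sub_smul_one_mem_ideal ℤ s) _))

theorem mem_diffOp_of_isPowLinear {e : ℕ} (hF : (iterateFrobenius R p e).Finite)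
    {δ : Module.End ℤ R} (h : IsPowLinear p e e δ) : δ ∈ diffOp R := by
  let k := (iterateFrobenius R p e).range
  have : Module.Finite k R := RingHom.Finite.of_comp_finite
    (f := (iterateFrobenius R p e).rangeRestrict) (g := k.subtype) hF
  let δ' : Module.End k R :=
    { δ with
      map_smul' := by
        rintro ⟨_, s, rfl⟩ x
        exact h s x }
  exact exists_isDiffOp_of_pow_mem_range (fun r => ⟨⟨_, r, rfl⟩, rfl⟩) δ'

end PowLinear

section TwistedDiffOp

variable {R : Type u} [CommRing R] {p : ℕ} [Fact p.Prime] [CharP R p] {a b c e : ℕ}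

variable (R p) in
/-- The differential operators `F^a_* R → F^b_* R`, as a left `D_R`-module. They are encoded as
the additive maps that are linear over some subring `R^{p^f}` acting through `F^a` and `F^b`. -/
def twistedDiffOp (a b : ℕ) : Submodule (diffOp R) (Module.End ℤ R) where
  carrier := {φ | ∃ f, IsPowLinear p (f + a) (f + b) φ}
  zero_mem' := ⟨0, .zero⟩
  add_mem' := by
    rintro φ ψ ⟨f, hφ⟩ ⟨g, hψ⟩
    refine ⟨g + f, .add ?_ ?_⟩
    · simpa only [add_assoc] using hφ.shift g
    · simpa only [add_assoc, add_left_comm, add_comm] using hψ.shift f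
  smul_mem' := by
    rintro ⟨δ, n, hδ⟩ φ ⟨g, hφ⟩
    obtain ⟨f, hf⟩ := exists_isPowLinear_of_isDiffOp (p := p) hδ
    refine ⟨f + g, .mul (b := f + (g + b)) ?_ ?_⟩
    · simpa only [add_assoc, add_left_comm, add_comm] using hf.shift (g + b)
    · simpa only [add_assoc] using hφ.shift f

theorem mul_mem_twistedDiffOp {φ ψ : Module.End ℤ R} (hφ : φ ∈ twistedDiffOp R p b c)
    (hψ : ψ ∈ twistedDiffOp R p a b) : φ * ψ ∈ twistedDiffOp R p a c := by
  obtain ⟨f, hφ⟩ := hφ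
  obtain ⟨g, hψ⟩ := hψ
  refine ⟨f + g, .mul (b := f + (g + b)) ?_ ?_⟩
  · simpa only [add_assoc, add_left_comm] using hφ.shift g
  · simpa only [add_assoc] using hψ.shift f

theorem mem_twistedDiffOp_of_mem_diffOp {δ : Module.End ℤ R} (hδ : δ ∈ diffOp R) :
    δ ∈ twistedDiffOp R p a a := by
  obtain ⟨n, hn⟩ := hδ
  obtain ⟨f, hf⟩ := exists_isPowLinear_of_isDiffOp (p := p) hn
  exact ⟨f, by simpa only [add_comm] using hf.shift a⟩

theorem finite_iterateFrobenius (hF : (frobenius R p).Finite) (e : ℕ) :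
    (iterateFrobenius R p e).Finite :=
  iterateFrobenius_induction (.id R) (fun hf hg => hf.comp hg) hF e

theorem mem_diffOp_of_mem_twistedDiffOp (hF : (frobenius R p).Finite) {δ : Module.End ℤ R}
    (hδ : δ ∈ twistedDiffOp R p a a) : δ ∈ diffOp R := by
  obtain ⟨f, hf⟩ := hδ
  exact mem_diffOp_of_isPowLinear (finite_iterateFrobenius hF _) hf

/-- The right action of `D_R` on the differential operators `F^a_* R → F^b_* R`. -/
def rightMul (δ : diffOp R) : twistedDiffOp R p a b →ₗ[diffOp R] twistedDiffOp R p a b where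
  toFun φ := ⟨φ.1 * δ.1, mul_mem_twistedDiffOp φ.2 (mem_twistedDiffOp_of_mem_diffOp δ.2)⟩
  map_add' φ ψ := Subtype.ext (add_mul φ.1 ψ.1 δ.1)
  map_smul' ε φ := Subtype.ext (mul_assoc ε.1 φ.1 δ.1)

@[simp]
theorem coe_rightMul (δ : diffOp R) (φ : twistedDiffOp R p a b) :
    (rightMul δ φ : Module.End ℤ R) = φ.1 * δ.1 := rfl

variable (p e) in
/-- The map `s ↦ r * s ^ p ^ e`, as a differential operator `R → F^e_* R`. -/
def frobOp : R →+ twistedDiffOp R p 0 e where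
  toFun r := ⟨LinearMap.mulLeft ℤ r * (iterateFrobenius R p e).toAddMonoidHom.toIntLinearMap, 0,
    .mul (.mulLeft r) fun s x => by simp [iterateFrobenius_def, mul_pow]⟩
  map_zero' := by ext; simp
  map_add' r s := by ext; simp [add_mul]

@[simp]
theorem coe_frobOp_apply (r s : R) : (frobOp p e r : Module.End ℤ R) s = r * s ^ p ^ e := rfl

theorem rightMul_ofRing_frobOp (r a : R) :
    rightMul (ofRing R a) (frobOp p e r) = frobOp p e (a ^ p ^ e * r) := by
  ext s
  change r * (a * s) ^ p ^ e = a ^ p ^ e * r * s ^ p ^ e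
  ring

theorem ofRing_smul_frobOp (s r : R) : ofRing R s • frobOp p e r = frobOp p e (s * r) := by
  ext t
  exact (mul_assoc s r _).symm

variable [hF : Fact (frobenius R p).Finite]

/-- The Morita pairing of twisted differential operators in opposite directions, given by
composition. -/
def pairing (φ : twistedDiffOp R p b a) (ψ : twistedDiffOp R p a b) : diffOp R :=
  ⟨φ.1 * ψ.1, mem_diffOp_of_mem_twistedDiffOp hF.out (mul_mem_twistedDiffOp φ.2 ψ.2)⟩

@[simp]
theorem coe_pairing (φ : twistedDiffOp R p b a) (ψ : twistedDiffOp R p a b) :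
    (pairing φ ψ : Module.End ℤ R) = φ.1 * ψ.1 := rfl

end TwistedDiffOp

section FrobeniusDualBasis

variable (R : Type u) [CommRing R] (p e : ℕ)

/-- A finite dual basis of the `R`-module `F^e_* R`; its coordinate functions are encoded as
additive maps. -/
structure FrobeniusDualBasis where
  /-- The number of generators. -/
  card : ℕ
  /-- The generators. -/
  gen : Fin card → R
  /-- The coordinate functions. -/
  coord : Fin card → Module.End ℤ R
  coord_isPowLinear : ∀ i, IsPowLinear p e 0 (coord i)
  sum_coord_pow_mul_gen : ∀ r, ∑ i, coord i r ^ p ^ e * gen i = r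

variable {R p e}

theorem FrobeniusDualBasis.exists_isPowLinear_apply_one_eq_one [Fact p.Prime]
    (B : FrobeniusDualBasis R p e) : ∃ σ, IsPowLinear p e 0 σ ∧ σ (1 : R) = 1 := by
  let I : Ideal R :=
    { carrier := {r | ∃ σ, IsPowLinear p e 0 σ ∧ σ 1 = r}
      add_mem' := by
        rintro _ _ ⟨σ, hσ, rfl⟩ ⟨τ, hτ, rfl⟩
        exact ⟨σ + τ, hσ.add hτ, rfl⟩
      zero_mem' := ⟨0, .zero, rfl⟩
      smul_mem' := by
        rintro r _ ⟨σ, hσ, rfl⟩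
        exact ⟨LinearMap.mulLeft ℤ r * σ, .mul (.mulLeft r) hσ, rfl⟩ }
  suffices h : I = ⊤ from (Ideal.eq_top_iff_one I).1 h
  by_contra hI
  obtain ⟨m, hm, hle⟩ := Ideal.exists_le_maximal I hI
  refine hm.ne_top ((Ideal.eq_top_iff_one m).2 ?_)
  rw [← B.sum_coord_pow_mul_gen 1]
  exact Ideal.sum_mem _ fun i _ => Ideal.mul_mem_right _ _ (Ideal.pow_mem_of_mem _
    (hle ⟨B.coord i, B.coord_isPowLinear i, rfl⟩) _ (pow_pos (NeZero.pos p) _))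

theorem exists_dualBasis {A B : Type*} [CommRing A] [CommRing B] {f : A →+* B} (hfin : f.Finite)
    (hfp : f.FinitePresentation) (hflat : f.Flat) :
    ∃ (n : ℕ) (g : Fin n → B) (κ : Fin n → B →+ A),
      (∀ i a b, κ i (f a * b) = a * κ i b) ∧ ∀ b, ∑ i, f (κ i b) * g i = b := by
  algebraize [f]
  have : Module.Finite A B := hfin
  have : Algebra.FinitePresentation A B := hfp
  have : Module.Flat A B := hflat
  have : Module.FinitePresentation A B := .of_finite_of_finitePresentation A B
  have : Module.Projective A B := Module.Flat.projective_of_finitePresentation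
  obtain ⟨n, g, h, -, -, hgh⟩ := Module.Finite.exists_comp_eq_id_of_projective A B
  refine ⟨n, fun i => g (Pi.single i 1), fun i => (LinearMap.proj i ∘ₗ h).toAddMonoidHom,
    fun i a b => congrFun (h.map_smul a b) i, fun b => ?_⟩
  calc ∑ i, f (h b i) * g (Pi.single i 1) = g (∑ i, h b i • Pi.single i 1) := by
        rw [map_sum]
        exact Finset.sum_congr rfl fun i _ => by rw [map_smul, Algebra.smul_def]; rfl
    _ = g (h b) := by rw [← pi_eq_sum_univ']
    _ = b := LinearMap.congr_fun hgh b

variable [Fact p.Prime] [CharP R p]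

theorem nonempty_frobeniusDualBasis (hF : (frobenius R p).Finite)
    (hfp : (frobenius R p).FinitePresentation) (hflat : (frobenius R p).Flat) (e : ℕ) :
    Nonempty (FrobeniusDualBasis R p e) := by
  obtain ⟨n, g, κ, hκ, hsum⟩ := exists_dualBasis (finite_iterateFrobenius hF e)
    (iterateFrobenius_induction (.id R) (fun hf hg => hf.comp hg) hfp e)
    (iterateFrobenius_induction (.id R) (fun hf hg => .comp hg hf) hflat e)
  simp only [iterateFrobenius_def] at hκ hsum
  exact ⟨⟨n, g, fun i => (κ i).toIntLinearMap, fun i s x => by simpa using hκ i s x, hsum⟩⟩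

namespace FrobeniusDualBasis

variable (B : FrobeniusDualBasis R p e)

/-- The coordinate functions as differential operators `F^e_* R → R`. -/
def coordOp (i : Fin B.card) : twistedDiffOp R p e 0 :=
  ⟨B.coord i, 0, by simpa only [zero_add] using B.coord_isPowLinear i⟩

@[simp]
theorem coe_coordOp (i : Fin B.card) : (B.coordOp i : Module.End ℤ R) = B.coord i := rfl

variable [Fact (frobenius R p).Finite]

theorem sum_pairing_frobOp_coordOp : ∑ i, pairing (frobOp p e (B.gen i)) (B.coordOp i) = 1 := by
  ext r
  rw [AddSubmonoidClass.coe_finsetSum, LinearMap.sum_apply]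
  conv_rhs => rw [OneMemClass.coe_one, Module.End.one_apply, ← B.sum_coord_pow_mul_gen r]
  simp [mul_comm]

theorem pairing_coordOp_frobOp (i : Fin B.card) (r : R) :
    pairing (B.coordOp i) (frobOp p e r) = ofRing R (B.coord i r) := by
  ext s
  change B.coord i (r * s ^ p ^ e) = B.coord i r * s
  rw [mul_comm, B.coord_isPowLinear i]
  ring

theorem sum_rightMul_pairing_frobOp (φ : twistedDiffOp R p 0 e) :
    ∑ i, rightMul (pairing (B.coordOp i) φ) (frobOp p e (B.gen i)) = φ := by
  rw [← Subtype.coe_inj, ← one_mul φ.1, ← OneMemClass.coe_one (diffOp R),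
    ← B.sum_pairing_frobOp_coordOp]
  simp [Finset.sum_mul, mul_assoc]

end FrobeniusDualBasis

end FrobeniusDualBasis

section FrobeniusPullback

variable {R : Type u} [CommRing R] {p : ℕ} [Fact p.Prime] [CharP R p] {e : ℕ}

variable (p e) in
/-- The `R`-module `F^{e*} M`, in arbitrary universes. -/
abbrev Pullback (M : ModuleCat.{w} (diffOp R)) : ModuleCat.{max w u} R :=
  (ModuleCat.extendScalars (iterateFrobenius R p e)).obj ((toRMod R).obj M)

variable (p e) in
/-- The tensor `r ⊗ m` in `F^{e*} M`, as a biadditive function. -/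
def frobTmul (M : ModuleCat.{w} (diffOp R)) : R →+ M →+ Pullback p e M :=
  AddMonoidHom.mk'
    (fun r => AddMonoidHom.mk'
      (pureTensor (iterateFrobenius R p e) (M := (toRMod R).obj M) r)
      fun m n => TensorProduct.tmul_add (R := R) (N := (toRMod R).obj M) _ m n)
    fun r s => AddMonoidHom.ext fun m => TensorProduct.add_tmul (R := R)
      (M := (ModuleCat.restrictScalars (iterateFrobenius R p e)).obj (ModuleCat.of R R))
      (N := (toRMod R).obj M) r s m

variable {M : ModuleCat.{w} (diffOp R)}

theorem frobTmul_ofRing_smul (r a : R) (m : M) :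
    frobTmul p e M r (ofRing R a • m) = frobTmul p e M (a ^ p ^ e * r) m :=
  (TensorProduct.smul_tmul (R := R)
    (M := (ModuleCat.restrictScalars (iterateFrobenius R p e)).obj (ModuleCat.of R R))
    (N := (toRMod R).obj M) a r m).symm

theorem frobPullback_hom_ext {A : Type*} [AddCommMonoid A] {g h : Pullback p e M →+ A}
    (H : ∀ r m, g (frobTmul p e M r m) = h (frobTmul p e M r m)) : g = h :=
  AddMonoidHom.ext fun x => by
    induction x using TensorProduct.induction_on with
    | zero => exact (map_zero g).trans (map_zero h).symm
    | tmul r m => exact H r m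
    | add x y hx hy => exact (map_add g x y).trans ((congrArg₂ _ hx hy).trans (map_add h x y).symm)

/-- The additive function on `F^{e*} M` induced by a balanced biadditive function. -/
def frobLift {A : Type*} [AddCommMonoid A] (g : R →+ M →+ A)
    (hg : ∀ a r m, g (a ^ p ^ e * r) m = g r (ofRing R a • m)) : Pullback p e M →+ A :=
  TensorProduct.liftAddHom (R := R)
    (M := (ModuleCat.restrictScalars (iterateFrobenius R p e)).obj (ModuleCat.of R R))
    (N := (toRMod R).obj M) g hg

theorem FrobeniusDualBasis.sum_frobTmul_gen (B : FrobeniusDualBasis R p e) (r : R) (m : M) :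
    ∑ i, frobTmul p e M (B.gen i) (ofRing R (B.coord i r) • m) = frobTmul p e M r m := by
  simp only [frobTmul_ofRing_smul]
  conv_rhs => rw [← B.sum_coord_pow_mul_gen r, map_sum, AddMonoidHom.finsetSum_apply]

end FrobeniusPullback

section Action

variable {R : Type u} [CommRing R] {p : ℕ} [Fact p.Prime] [CharP R p]
  [Fact (frobenius R p).Finite] {e : ℕ} (B : FrobeniusDualBasis R p e)
  {M : ModuleCat.{w} (diffOp R)}

variable (M) in
/-- The identification `Hom(R, F^e_* R) ⊗ M ≅ F^{e*} M`, where the tensor product is that of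
`D_R`-modules, as a biadditive function. -/
def opTensor : twistedDiffOp R p 0 e →+ M →+ Pullback p e M :=
  AddMonoidHom.mk'
    (fun φ => ∑ i, (frobTmul p e M (B.gen i)).comp
      (DistribSMul.toAddMonoidHom M (pairing (B.coordOp i) φ)))
    fun φ ψ => by
      ext m
      simp [pairing, mul_add, ← Finset.sum_add_distrib, ← map_add, ← add_smul]

theorem opTensor_apply (φ : twistedDiffOp R p 0 e) (m : M) :
    opTensor B M φ m = ∑ i, frobTmul p e M (B.gen i) (pairing (B.coordOp i) φ • m) := by
  simp [opTensor]

theorem opTensor_rightMul (φ : twistedDiffOp R p 0 e) (δ : diffOp R) (m : M) :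
    opTensor B M (rightMul δ φ) m = opTensor B M φ (δ • m) := by
  simp only [opTensor_apply, ← mul_smul]
  rfl

theorem opTensor_frobOp (r : R) (m : M) :
    opTensor B M (frobOp p e r) m = frobTmul p e M r m := by
  simp only [opTensor_apply, B.pairing_coordOp_frobOp, B.sum_frobTmul_gen]

/-- The action of a differential operator on `F^{e*} M`. -/
def act (δ : diffOp R) : Pullback p e M →+ Pullback p e M :=
  frobLift ((opTensor B M).comp ((DistribSMul.toAddMonoidHom _ δ).comp (frobOp p e)))
    fun a r m => by
      change opTensor B M (δ • frobOp p e (a ^ p ^ e * r)) m =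
        opTensor B M (δ • frobOp p e r) (ofRing R a • m)
      rw [← rightMul_ofRing_frobOp, ← opTensor_rightMul]
      rfl

theorem act_frobTmul (δ : diffOp R) (r : R) (m : M) :
    act B δ (frobTmul p e M r m) = opTensor B M (δ • frobOp p e r) m := rfl

theorem act_opTensor (δ : diffOp R) (φ : twistedDiffOp R p 0 e) (m : M) :
    act B δ (opTensor B M φ m) = opTensor B M (δ • φ) m := by
  conv_rhs => rw [← B.sum_rightMul_pairing_frobOp φ]
  simp only [opTensor_apply B φ, map_sum, act_frobTmul, ← opTensor_rightMul, Finset.smul_sum,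
    AddMonoidHom.finsetSum_apply]
  rfl

theorem act_ofRing (s : R) (x : Pullback p e M) : act B (ofRing R s) x = s • x := by
  refine DFunLike.congr_fun (f := act B (ofRing R s)) (g := DistribSMul.toAddMonoidHom _ s)
    (frobPullback_hom_ext fun r m => ?_) x
  rw [act_frobTmul, ofRing_smul_frobOp, opTensor_frobOp]
  rfl

theorem act_mul (δ ε : diffOp R) (x : Pullback p e M) :
    act B (δ * ε) x = act B δ (act B ε x) := by
  refine DFunLike.congr_fun (f := act B (δ * ε)) (g := (act B δ).comp (act B ε))
    (frobPullback_hom_ext fun r m => ?_) x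
  rw [AddMonoidHom.comp_apply, act_frobTmul, act_frobTmul, act_opTensor, mul_smul]

theorem act_add (δ ε : diffOp R) (x : Pullback p e M) :
    act B (δ + ε) x = act B δ x + act B ε x := by
  refine DFunLike.congr_fun (f := act B (δ + ε)) (g := act B δ + act B ε)
    (frobPullback_hom_ext fun r m => ?_) x
  rw [AddMonoidHom.add_apply, act_frobTmul, act_frobTmul, act_frobTmul, add_smul, map_add,
    AddMonoidHom.add_apply]

/-- `F^{e*} M` as a `D_R`-module. -/
abbrev actModule (M : ModuleCat.{w} (diffOp R)) : Module (diffOp R) (Pullback p e M) where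
  smul δ x := act B δ x
  one_smul x := by
    change act B 1 x = x
    rw [← map_one (ofRing R), act_ofRing, one_smul]
  mul_smul := act_mul B
  smul_zero δ := map_zero (act B δ)
  smul_add δ := map_add (act B δ)
  add_smul := act_add B
  zero_smul x := by
    change act B 0 x = 0
    rw [← map_zero (ofRing R), act_ofRing, zero_smul]

end Action

section NaturalStructure

variable {R : Type u} [CommRing R] {p e f : ℕ}

theorem IsHorizontal.smul_eq_ofRing_smul {M : ModuleCat.{w} (diffOp R)} {m : M}
    (hm : IsHorizontal R p f m) {δ : diffOp R} (hδ : HasLevel R p f δ) :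
    δ • m = ofRing R (δ.1 1) • m := by
  rw [← sub_eq_zero, ← sub_smul]
  refine hm _ (fun s x => ?_) ?_
  · change δ.1 (s ^ p ^ f * x) - δ.1 1 * (s ^ p ^ f * x) = s ^ p ^ f * (δ.1 x - δ.1 1 * x)
    rw [hδ]
    ring
  · change δ.1 1 - δ.1 1 * 1 = 0
    ring

variable [Fact p.Prime] [CharP R p] [Fact (frobenius R p).Finite]

namespace FrobeniusDualBasis

variable (B : FrobeniusDualBasis R p e)

theorem hasLevel_pairing_coordOp {δ : diffOp R} (hδ : HasLevel R p (e + f) δ) (r : R)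
    (i : Fin B.card) : HasLevel R p f (pairing (B.coordOp i) (δ • frobOp p e r)) := fun s x => by
  change B.coord i (δ.1 (r * (s ^ p ^ f * x) ^ p ^ e)) =
    s ^ p ^ f * B.coord i (δ.1 (r * x ^ p ^ e))
  have hpow : r * (s ^ p ^ f * x) ^ p ^ e = s ^ p ^ (e + f) * (r * x ^ p ^ e) := by ring
  rw [hpow, hδ, add_comm, pow_add, pow_mul, B.coord_isPowLinear i, pow_zero, pow_one]

theorem isHorizontal_pairing_frobOp_coordOp {M : ModuleCat.{w} (diffOp R)} (i : Fin B.card)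
    (m : M) : IsHorizontal R p e (pairing (frobOp p e 1) (B.coordOp i) • m) := by
  intro δ hδ h1
  have hzero : δ * pairing (frobOp p e 1) (B.coordOp i) = 0 := by
    ext x
    change δ.1 (1 * B.coord i x ^ p ^ e) = 0
    rw [mul_comm, hδ, h1, mul_zero]
  rw [← mul_smul, hzero, zero_smul]

/-- The natural structure on `F^{e*} M` which is defined by a dual basis. -/
def naturalStructure (M : ModuleCat.{max u v} (diffOp R)) : NaturalStructure.{u, v} R p e M where
  toModule := actModule B M
  ofRing_smul := act_ofRing B
  smul_tensor f δ r m hδ hm := by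
    change act B δ (frobTmul p e M r m) = frobTmul p e M (δ.1 r) m
    rw [act_frobTmul, opTensor_apply, ← B.sum_frobTmul_gen]
    refine Finset.sum_congr rfl fun i _ => ?_
    rw [hm.smul_eq_ofRing_smul (B.hasLevel_pairing_coordOp hδ r i)]
    change frobTmul p e M _ (ofRing R (B.coord i (δ.1 (r * 1 ^ p ^ e))) • m) = _
    rw [one_pow, mul_one]

theorem sum_ofRing_smul_pairing_smul {M : ModuleCat.{w} (diffOp R)} (m : M) :
    ∑ i, ofRing R (B.gen i) • pairing (frobOp p e 1) (B.coordOp i) • m = m := by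
  conv_rhs => rw [← one_smul (diffOp R) m, ← B.sum_pairing_frobOp_coordOp, Finset.sum_smul]
  refine Finset.sum_congr rfl fun i _ => ?_
  rw [← mul_smul]
  congr 1
  ext x
  change B.gen i * (1 * _) = B.gen i * _
  rw [one_mul]

end FrobeniusDualBasis

theorem NaturalStructure.smul_frobTmul_eq {M : ModuleCat.{max u v} (diffOp R)}
    (S : NaturalStructure.{u, v} R p e M) (C : FrobeniusDualBasis R p f) {δ : diffOp R}
    (hδ : HasLevel R p (e + f) δ) (r : R) (m : M) :
    S.toModule.smul δ (frobTmul p e M r m) = ∑ i, frobTmul p e M (δ.1 (C.gen i ^ p ^ e * r))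
      (pairing (frobOp p f 1) (C.coordOp i) • m) := by
  let := S.toModule
  conv_lhs => rw [← C.sum_ofRing_smul_pairing_smul m, map_sum]
  refine (Finset.smul_sum (r := δ)).trans (Finset.sum_congr rfl fun i _ => ?_)
  rw [frobTmul_ofRing_smul]
  exact S.smul_tensor f δ _ _ hδ (C.isHorizontal_pairing_frobOp_coordOp i m)

theorem subsingleton_naturalStructure (hB : ∀ f, Nonempty (FrobeniusDualBasis R p f))
    (M : ModuleCat.{max u v} (diffOp R)) : Subsingleton (NaturalStructure.{u, v} R p e M) := by
  refine ⟨fun S T => NaturalStructure.ext (Module.ext' _ _ fun δ x => ?_)⟩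
  obtain ⟨n, hn⟩ := δ.2
  obtain ⟨f, hf⟩ := exists_isPowLinear_of_isDiffOp (p := p) hn
  obtain ⟨C⟩ := hB f
  let act (S : NaturalStructure.{u, v} R p e M) : Pullback p e M →+ Pullback p e M :=
    letI := S.toModule
    DistribSMul.toAddMonoidHom _ δ
  refine DFunLike.congr_fun (f := act S) (g := act T) (frobPullback_hom_ext fun r m => ?_) x
  exact (S.smul_frobTmul_eq C (hf.shift e) r m).trans (T.smul_frobTmul_eq C (hf.shift e) r m).symm

theorem isFunctorial_naturalStructure (B : FrobeniusDualBasis R p e) :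
    IsFunctorial B.naturalStructure.{u, v} := by
  intro M M' φ δ x
  let F : Pullback p e M →+ Pullback p e M' :=
    ((frobPullback.{u, v} R p e).map ((toRMod R).map φ)).hom.toAddMonoidHom
  have hF (r : R) (m : M) : F (frobTmul p e M r m) = frobTmul p e M' r (φ.hom m) := rfl
  refine DFunLike.congr_fun (f := F.comp (act B δ)) (g := (act B δ).comp F)
    (frobPullback_hom_ext fun r m => ?_) x
  simp only [AddMonoidHom.comp_apply, hF, act_frobTmul, opTensor_apply, map_sum, map_smul]

end NaturalStructure

section Contraction

variable {R : Type u} [CommRing R] {p : ℕ} [Fact p.Prime] [CharP R p]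
  [Fact (frobenius R p).Finite] {e : ℕ}

/-- The pairing of the differential operators `F^e_* R → R` with `F^{e*} M`. -/
def contract (M : ModuleCat.{w} (diffOp R)) (ψ : twistedDiffOp R p e 0) : Pullback p e M →+ M :=
  frobLift
    (AddMonoidHom.mk' (fun r => DistribSMul.toAddMonoidHom M (pairing ψ (frobOp p e r)))
      fun r s => by
        ext m
        simp [pairing, mul_add, ← add_smul])
    fun a r m => by
      change pairing ψ (frobOp p e (a ^ p ^ e * r)) • m = pairing ψ (frobOp p e r) • ofRing R a • m
      rw [← rightMul_ofRing_frobOp, ← mul_smul]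
      rfl

variable {M : ModuleCat.{w} (diffOp R)} (B : FrobeniusDualBasis R p e)

theorem contract_frobTmul (ψ : twistedDiffOp R p e 0) (r : R) (m : M) :
    contract M ψ (frobTmul p e M r m) = pairing ψ (frobOp p e r) • m := rfl

theorem opTensor_contract (φ : twistedDiffOp R p 0 e) (ψ : twistedDiffOp R p e 0)
    (x : Pullback p e M) : opTensor B M φ (contract M ψ x) = act B (pairing φ ψ) x := by
  refine DFunLike.congr_fun (f := (opTensor B M φ).comp (contract M ψ))
    (g := act B (pairing φ ψ)) (frobPullback_hom_ext fun r m => ?_) x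
  rw [AddMonoidHom.comp_apply, contract_frobTmul, act_frobTmul, ← opTensor_rightMul]
  rfl

end Contraction

section Descent

variable {R : Type u} [CommRing R] {p : ℕ} [Fact p.Prime] [CharP R p] {e : ℕ}
  (N : ModuleCat.{w} (diffOp R))

variable (p e) in
/-- The `D_R`-module of `D_R`-linear functions `Hom(R, F^e_* R) → N`, on which `D_R` acts through
its right action on `Hom(R, F^e_* R)`. This is the inverse of `F^{e*}`. -/
def descent : ModuleCat.{max u w} (diffOp R) :=
  letI : Module (diffOp R) (twistedDiffOp R p 0 e →ₗ[diffOp R] N) :=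
    { smul δ h := h ∘ₗ rightMul δ
      one_smul h := LinearMap.ext fun φ => congrArg h (Subtype.ext (mul_one φ.1))
      mul_smul δ ε h :=
        LinearMap.ext fun φ => congrArg h (Subtype.ext (mul_assoc φ.1 δ.1 ε.1).symm)
      smul_zero _ := LinearMap.zero_comp _
      smul_add _ _ _ := LinearMap.add_comp _ _ _
      add_smul δ ε h := LinearMap.ext fun φ =>
        (congrArg h (Subtype.ext (mul_add φ.1 δ.1 ε.1))).trans (map_add h _ _)
      zero_smul h := LinearMap.ext fun φ =>
        (congrArg h (Subtype.ext (mul_zero φ.1))).trans (map_zero h) }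
  ModuleCat.of (diffOp R) (twistedDiffOp R p 0 e →ₗ[diffOp R] N)

variable (p e) in
/-- The evaluation of the elements of `descent p e N`, as a biadditive function. -/
def descentEval : twistedDiffOp R p 0 e →+ descent p e N →+ N :=
  AddMonoidHom.mk' (fun φ => LinearMap.evalAddMonoidHom φ) fun φ φ' =>
    AddMonoidHom.ext fun h : twistedDiffOp R p 0 e →ₗ[diffOp R] N => map_add h φ φ'

variable {N}

theorem descent_ext {h h' : descent p e N}
    (H : ∀ φ, descentEval p e N φ h = descentEval p e N φ h') : h = h' := LinearMap.ext H

theorem descentEval_rightMul (δ : diffOp R) (φ : twistedDiffOp R p 0 e) (h : descent p e N) :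
    descentEval p e N (rightMul δ φ) h = descentEval p e N φ (δ • h) := rfl

theorem descentEval_smul (δ : diffOp R) (φ : twistedDiffOp R p 0 e) (h : descent p e N) :
    descentEval p e N (δ • φ) h = δ • descentEval p e N φ h :=
  LinearMap.map_smul (M := twistedDiffOp R p 0 e) (M₂ := N) h δ φ

variable (p e N) in
/-- The evaluation `r ⊗ h ↦ h (r * F^e)`. -/
def descentCounit : Pullback p e (descent p e N) →+ N :=
  frobLift ((descentEval p e N).comp (frobOp p e)) fun a r h => by
    rw [AddMonoidHom.comp_apply, ← rightMul_ofRing_frobOp]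
    rfl

variable [Fact (frobenius R p).Finite] (B : FrobeniusDualBasis R p e)

theorem descentCounit_opTensor (φ : twistedDiffOp R p 0 e) (h : descent p e N) :
    descentCounit p e N (opTensor B _ φ h) = descentEval p e N φ h := by
  conv_rhs => rw [← B.sum_rightMul_pairing_frobOp φ]
  simp only [opTensor_apply, map_sum, AddMonoidHom.finsetSum_apply, descentEval_rightMul]
  rfl

theorem descentCounit_act (δ : diffOp R) (x : Pullback p e (descent p e N)) :
    descentCounit p e N (act B δ x) = δ • descentCounit p e N x := by
  refine DFunLike.congr_fun (f := (descentCounit p e N).comp (act B δ))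
    (g := (DistribSMul.toAddMonoidHom N δ).comp (descentCounit p e N))
    (frobPullback_hom_ext fun r h => ?_) x
  rw [AddMonoidHom.comp_apply, act_frobTmul, descentCounit_opTensor, descentEval_smul]
  rfl

/-- The function `φ ↦ φ ψ • n`. -/
def coeval (ψ : twistedDiffOp R p e 0) : N →+ descent p e N :=
  AddMonoidHom.mk'
    (fun n =>
      { toFun := fun φ => pairing φ ψ • n
        map_add' := fun φ φ' => by
          rw [← add_smul]
          exact congrArg (· • n) (Subtype.ext (add_mul φ.1 φ'.1 ψ.1))
        map_smul' := fun δ φ => mul_smul δ (pairing φ ψ) n })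
    fun n n' => LinearMap.ext fun φ => smul_add _ n n'

theorem descentEval_coeval (φ : twistedDiffOp R p 0 e) (ψ : twistedDiffOp R p e 0) (n : N) :
    descentEval p e N φ (coeval ψ n) = pairing φ ψ • n := rfl

theorem coeval_descentEval (ψ : twistedDiffOp R p e 0) (φ : twistedDiffOp R p 0 e)
    (h : descent p e N) : coeval ψ (descentEval p e N φ h) = pairing ψ φ • h :=
  descent_ext fun φ' => by
    rw [descentEval_coeval, ← descentEval_smul, ← descentEval_rightMul]
    rfl

include B in
theorem bijective_descentCounit : Function.Bijective (descentCounit p e N) := by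
  let η : N →+ Pullback p e (descent p e N) :=
    ∑ i, (frobTmul p e _ (B.gen i)).comp (coeval (B.coordOp i))
  have hη (n : N) : η n = ∑ i, frobTmul p e _ (B.gen i) (coeval (B.coordOp i) n) := by simp [η]
  have hcounit (r : R) (h : descent p e N) :
      descentCounit p e N (frobTmul p e _ r h) = descentEval p e N (frobOp p e r) h := rfl
  refine Function.bijective_iff_has_inverse.2 ⟨η, fun x => ?_, fun n => ?_⟩
  · refine DFunLike.congr_fun (f := η.comp (descentCounit p e N)) (g := AddMonoidHom.id _)
      (frobPullback_hom_ext fun r h => ?_) x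
    simp only [AddMonoidHom.comp_apply, hcounit, hη, coeval_descentEval]
    rw [← opTensor_apply, opTensor_frobOp, AddMonoidHom.id_apply]
  · simp only [hη, map_sum, hcounit, descentEval_coeval, ← Finset.sum_smul,
      B.sum_pairing_frobOp_coordOp, one_smul]

end Descent

section Equivalence

variable {R : Type u} [CommRing R] {p : ℕ} [Fact p.Prime] [CharP R p]
  [Fact (frobenius R p).Finite] {e : ℕ} (B : FrobeniusDualBasis R p e)

/-- The functor `F^{e*}` on `D_R`-modules which is defined by a dual basis. -/
abbrev FrobeniusDualBasis.functor :
    ModuleCat.{max u v} (diffOp R) ⥤ ModuleCat.{max u v} (diffOp R) :=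
  frobFunctor _ (isFunctorial_naturalStructure.{u, v} B)

include B in
theorem FrobeniusDualBasis.exists_pairing_frobOp_one_eq_one :
    ∃ σ : twistedDiffOp R p e 0, pairing σ (frobOp p e 1) = 1 := by
  obtain ⟨σ, hσ, hσ1⟩ := B.exists_isPowLinear_apply_one_eq_one
  refine ⟨⟨σ, 0, by simpa only [zero_add] using hσ⟩, ?_⟩
  ext x
  change σ (1 * x ^ p ^ e) = x
  rw [mul_comm, hσ, hσ1]
  ring

include B in
theorem injective_frobTmul_one (M : ModuleCat.{w} (diffOp R)) :
    Function.Injective (frobTmul p e M 1) := by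
  obtain ⟨σ, hσ⟩ := B.exists_pairing_frobOp_one_eq_one
  exact Function.LeftInverse.injective (g := contract M σ) fun m => by
    rw [contract_frobTmul, hσ, one_smul]

theorem exists_hom_of_act {M M' : ModuleCat.{w} (diffOp R)}
    (g : Pullback p e M →+ Pullback p e M') (hg : ∀ δ x, g (act B δ x) = act B δ (g x)) :
    ∃ φ : M →ₗ[diffOp R] M', ∀ r m, g (frobTmul p e M r m) = frobTmul p e M' r (φ m) := by
  obtain ⟨σ, hσ⟩ := B.exists_pairing_frobOp_one_eq_one
  let φ : M →+ M' := (contract M' σ).comp (g.comp (frobTmul p e M 1))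
  have hopTensor (α : twistedDiffOp R p 0 e) (m : M) :
      g (opTensor B M α m) = opTensor B M' α (φ m) := by
    change _ = opTensor B M' α (contract M' σ (g (frobTmul p e M 1 m)))
    rw [opTensor_contract, ← hg, ← opTensor_contract B α σ (frobTmul p e M 1 m),
      contract_frobTmul, hσ, one_smul]
  refine ⟨{ φ with map_smul' := fun δ m => ?_ }, fun r m => ?_⟩
  · apply injective_frobTmul_one (p := p) B
    calc frobTmul p e M' 1 (φ (δ • m))
      _ = opTensor B M' (frobOp p e 1) (φ (δ • m)) := (opTensor_frobOp B 1 _).symm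
      _ = g (opTensor B M (rightMul δ (frobOp p e 1)) m) := by
        rw [← hopTensor, opTensor_rightMul B]
      _ = frobTmul p e M' 1 (δ • φ m) := by
        rw [hopTensor, opTensor_rightMul B, opTensor_frobOp B]
  · calc g (frobTmul p e M r m)
      _ = g (opTensor B M (frobOp p e r) m) := by rw [opTensor_frobOp B]
      _ = frobTmul p e M' r (φ m) := by rw [hopTensor, opTensor_frobOp B]

theorem faithful_functor : B.functor.{u, v}.Faithful where
  map_injective {M M' φ ψ} h := by
    ext m
    exact injective_frobTmul_one B M' (congrArg (fun g => g.hom (frobTmul p e M 1 m)) h)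

theorem full_functor : B.functor.{u, v}.Full where
  map_surjective {M M'} g := by
    obtain ⟨φ, hφ⟩ := exists_hom_of_act B (M := M) (M' := M') g.hom.toAddMonoidHom
      g.hom.map_smul
    exact ⟨ModuleCat.ofHom φ, ModuleCat.hom_ext (LinearMap.toAddMonoidHom_injective
      (frobPullback_hom_ext fun r m => (hφ r m).symm))⟩

theorem essSurj_functor : B.functor.{u, v}.EssSurj where
  mem_essImage N := by
    let counit : B.functor.obj (descent p e N) →ₗ[diffOp R] N :=
      { toFun := descentCounit p e N
        map_add' := map_add _
        map_smul' := descentCounit_act B }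
    exact ⟨_, ⟨(LinearEquiv.ofBijective counit (bijective_descentCounit B)).toModuleIso⟩⟩

theorem isEquivalence_functor : B.functor.{u, v}.IsEquivalence where
  faithful := faithful_functor B
  full := full_functor B
  essSurj := essSurj_functor B

end Equivalence

end FrobDescent

end

open FrobDescent in
theorem mainTheorem5_general (R : Type u) [CommRing R] (p : ℕ) [Fact p.Prime] [CharP R p]
    (hF : (frobenius R p).Finite) (hfp : (frobenius R p).FinitePresentation)
    (hflat : (frobenius R p).Flat) (e : ℕ) :
    ∃ S : ∀ M : ModuleCat.{max u v} (diffOp R), NaturalStructure.{u, v} R p e M,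
      (∀ M (T : NaturalStructure.{u, v} R p e M), T = S M) ∧
      ∃ hS : IsFunctorial S, (frobFunctor S hS).IsEquivalence := by
  have : Fact (frobenius R p).Finite := ⟨hF⟩
  have hB := nonempty_frobeniusDualBasis hF hfp hflat
  obtain ⟨B⟩ := hB e
  exact ⟨B.naturalStructure, fun M T => (subsingleton_naturalStructure hB M).elim T _,
    isFunctorial_naturalStructure B, isEquivalence_functor B⟩

theorem mainTheorem5 (R : Type u) [CommRing R] (p : ℕ) [Fact p.Prime] [CharP R p]
    [IsRegularRing R] (hF : (frobenius R p).Finite) (e : ℕ) :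
    ∃ S : ∀ M : ModuleCat.{max u v} (FrobDescent.diffOp R),
        FrobDescent.NaturalStructure.{u, v} R p e M,
      (∀ M (T : FrobDescent.NaturalStructure.{u, v} R p e M), T = S M) ∧
      ∃ hS : FrobDescent.IsFunctorial S, (FrobDescent.frobFunctor S hS).IsEquivalence := by
  exact mainTheorem5_general R p hF (RingHom.FinitePresentation.of_finiteType.1 hF.finiteType)
    (FrobDescent.frobenius_flat_of_isRegularRing hF) e
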